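/- Let $\mathcal{N}=\{1,\dots,n\}$ be a set of products. A marginal distribution model (MDM) consists of deterministic utilities $\nu_1,\dots,\nu_n\in\mathbb{R}$ and laws of real random variables $\tilde\epsilon_1,\dots,\tilde\epsilon_n$, each absolutely continuous, with finite first moment and with a distribution function $F_i$ that is strictly increasing on its support. For a nonempty assortment $S\subseteq\mathcal{N}$, its choice probabilities are $p_{i,S}=\mathbb{P}_{\theta^*}\big(i\in\arg\max_{j\in S}\{\nu_j+\tilde\epsilon_j\}\big)$, $i\in S$, where $\theta^*$ attains the maximum of $\mathbb{E}_\theta\big[\max_{j\in S}\{\nu_j+\tilde\epsilon_j\}\big]$ over all joint distributions $\theta$ of $(\tilde\epsilon_1,\dots,\tilde\epsilon_n)$ with marginals $F_1,\dots,F_n$. For a collection $\mathcal{S}$ of assortments, let $\mathcal{P}_{\rm mdm}(\mathcal{S})$ be the set of all families $(p_{i,S}: S\in\mathcal{S}, i\in S)$ with $p_{i,S}\ge 0$ and $\sum_{i\in S}p_{i,S}=1$ for every $S\in\mathcal{S}$ that are the choice probabilities of a single MDM for all $S\in\mathcal{S}$. Let $\mathcal{S}=\{S_1,\dots,S_m\}$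 be nested, $S_1\subset S_2\subset\dots\subset S_m$ (strict inclusions, $m=|\mathcal{S}|\ge 0$), let $p_{\mathcal{S}}\in\mathcal{P}_{\rm mdm}(\mathcal{S})$, let $r_i>0$ for $i\in\mathcal{N}$, and let $A\subseteq\mathcal{N}$ be a nonempty assortment with $A\notin\mathcal{S}$. The worst-case expected revenue of $A$ is $$\underline{r}(A)=\inf\Big\{\sum_{i\in A}r_i x_{i,A}\;:\;(p_{\mathcal{S}},x_A)\in\mathcal{P}_{\rm mdm}(\mathcal{S}\cup\{A\})\Big\}.$$ Then $$\underline{r}(A)=\min_{k=0,1,\dots,m} R_k,$$ where $R_k$ is the optimal value ($+\infty$ if infeasible) of the linear program $$\begin{aligned}R_k=\min_{x_A}\ &\sum_{i\in A}r_i x_{i,A}\\ \text{s.t. }\ & x_{i,A}\le p_{i,S_k}\quad \forall\, i\in A\cap S_k,\\ & x_{i,A}\ge p_{i,S}\quad \forall\, S\in\mathcal{S} \text{ with } S_{k+1}\subseteq S,\ \forall\, i\in A\cap S,\\ & \sum_{i\in A}x_{i,A}=1,\quad x_{i,A}\ge 0\quad \forall\, i\in A;\end{aligned}$$ the first family of constraints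 is absent for $k=0$ and the second is absent for $k=m$. Every feasible program among these attains its minimum, and at least one of them is feasible. -/

import Mathlib

open MeasureTheory

noncomputable section

/-- A marginal distribution model over the products `Fin n`: the deterministic utilities `ν i` and
the laws `μ i` of the random utility terms. Each law is absolutely continuous, has a finite first
moment, and its distribution function is strictly increasing on its support. -/
structure MDM (n : ℕ) where
  ν : Fin n → ℝ
  μ : Fin n → Measure ℝ
  isProbabilityMeasure : ∀ i, IsProbabilityMeasure (μ i)
  absolutelyContinuous : ∀ i, μ i ≪ volume
  strictMonoOn_cdf : ∀ i, StrictMonoOn (ProbabilityTheory.cdf (μ i)) (μ i).support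
  integrable : ∀ i, Integrable (fun t : ℝ => t) (μ i)

namespace MDM

variable {n : ℕ} (M : MDM n)

/-- All joint laws of the random utility terms with the given marginals. -/
def jointLaws : Set (Measure (Fin n → ℝ)) :=
  {θ | IsProbabilityMeasure θ ∧ ∀ i, θ.map (fun ε => ε i) = M.μ i}

/-- Expected utility of the best product of the (nonempty) assortment `S` under `θ`. -/
def expectedMaxUtility (S : Finset (Fin n)) (θ : Measure (Fin n → ℝ)) : ℝ :=
  ∫ ε, (⨆ i : {i // i ∈ S}, (M.ν i + ε i)) ∂θ

/-- `θ` attains the supremum of the expected maximal utility over all joint laws. -/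
def IsExtremal (S : Finset (Fin n)) (θ : Measure (Fin n → ℝ)) : Prop :=
  θ ∈ M.jointLaws ∧
    ∀ θ' ∈ M.jointLaws, M.expectedMaxUtility S θ' ≤ M.expectedMaxUtility S θ

/-- The event that product `i` maximizes the utility over the assortment `S`. -/
def argmaxEvent (S : Finset (Fin n)) (i : Fin n) : Set (Fin n → ℝ) :=
  {ε | ∀ j ∈ S, M.ν j + ε j ≤ M.ν i + ε i}

/-- The numbers `q i`, `i ∈ S`, are the choice probabilities of the model for the assortment `S`:
those of a joint law attaining the maximal expected utility. -/
def Generates (S : Finset (Fin n)) (q : Fin n → ℝ) : Prop :=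
  ∃ θ, M.IsExtremal S θ ∧ ∀ i ∈ S, q i = θ.real (M.argmaxEvent S i)

end MDM

/-- The probability simplex over `A`; only the coordinates in `A` matter. -/
def simplexOn {n : ℕ} (A : Finset (Fin n)) : Set (Fin n → ℝ) :=
  {x | (∀ i ∈ A, 0 ≤ x i) ∧ ∑ i ∈ A, x i = 1}

/-- The choice probability collections over the assortments in `𝒮` that are representable by one
marginal distribution model. The number `p S i` is the probability of choosing `i` from `S`; only
the values with `S ∈ 𝒮` and `i ∈ S` matter. -/
def mdmProbabilities {n : ℕ} (𝒮 : Finset (Finset (Fin n))) :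
    Set (Finset (Fin n) → Fin n → ℝ) :=
  {p | (∀ S ∈ 𝒮, p S ∈ simplexOn S) ∧ ∃ M : MDM n, ∀ S ∈ 𝒮, M.Generates S (p S)}

/-- The choice probability vectors for a new assortment `A` (not in `𝒮`) that are consistent with
the data `p` over `𝒮`. -/
def consistentSet {n : ℕ} (𝒮 : Finset (Finset (Fin n))) (p : Finset (Fin n) → Fin n → ℝ)
    (A : Finset (Fin n)) : Set (Fin n → ℝ) :=
  {x | Function.update p A x ∈ mdmProbabilities (insert A 𝒮)}

/-- Expected revenue `∑ i ∈ A, r i * x i`. -/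
def revenue {n : ℕ} (r : Fin n → ℝ) (A : Finset (Fin n)) (x : Fin n → ℝ) : ℝ :=
  ∑ i ∈ A, r i * x i

/-- Infimum of the expected revenue over a set `C`, equal to `+∞` when `C` is empty. -/
def infRevenue {n : ℕ} (r : Fin n → ℝ) (A : Finset (Fin n)) (C : Set (Fin n → ℝ)) : EReal :=
  ⨅ x ∈ C, ((revenue r A x : ℝ) : EReal)

/-- The worst-case expected revenue of `A` over all consistent choice probability vectors. -/
def worstCaseRevenue {n : ℕ} (𝒮 : Finset (Finset (Fin n))) (p : Finset (Fin n) → Fin n → ℝ)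
    (r : Fin n → ℝ) (A : Finset (Fin n)) : EReal :=
  infRevenue r A (consistentSet 𝒮 p A)

/-- `S 0 ⊂ S 1 ⊂ ⋯ ⊂ S (m - 1)` lists exactly the members of `𝒮` (so `m` is the size of `𝒮`). -/
def IsNestedEnumeration {n m : ℕ} (𝒮 : Finset (Finset (Fin n)))
    (S : Fin m → Finset (Fin n)) : Prop :=
  StrictMono S ∧ ∀ T, T ∈ 𝒮 ↔ ∃ j, S j = T

/-- The feasible region of the `k`-th linear program, `0 ≤ k ≤ m`. In the 1-based indexing
`S₁ ⊂ ⋯ ⊂ Sₘ` one has `S_j = S (j - 1)`: the first family of constraints is about `S_k` and is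
absent for `k = 0`, the second is about the members of `𝒮` containing `S_{k+1}` and is absent
for `k = m`. -/
def nestedFeasible {n m : ℕ} (𝒮 : Finset (Finset (Fin n))) (S : Fin m → Finset (Fin n))
    (p : Finset (Fin n) → Fin n → ℝ) (A : Finset (Fin n)) (k : Fin (m + 1)) :
    Set (Fin n → ℝ) :=
  {x | (∀ j : Fin m, (j : ℕ) + 1 = k → ∀ i ∈ A ∩ S j, x i ≤ p (S j) i) ∧
    (∀ j : Fin m, (j : ℕ) = k → ∀ T ∈ 𝒮, S j ⊆ T → ∀ i ∈ A ∩ T, p T i ≤ x i) ∧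
    x ∈ simplexOn A}

/-- The value of the `k`-th linear program (`+∞` if it is infeasible). -/
def nestedValue {n m : ℕ} (𝒮 : Finset (Finset (Fin n))) (S : Fin m → Finset (Fin n))
    (p : Finset (Fin n) → Fin n → ℝ) (r : Fin n → ℝ) (A : Finset (Fin n)) (k : Fin (m + 1)) :
    EReal :=
  infRevenue r A (nestedFeasible 𝒮 S p A k)

end

/-! For any level `l`, the best utility in `S` is at most `l` plus the sum of the excesses over `l`,
and the expectation of this bound depends only on the marginals. If the exceedance probabilities
`P(ν i + ε i > l)` sum to one over `S`, a coupling in which exactly one product exceeds `l` attains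
the bound. Conversely, every extremal law then makes the product above `l` almost surely unique,
hence the maximizer. So the choice probabilities for `S` are the exceedance probabilities at a
common level (`generates_iff`), and a collection is representable iff one model and one level per
assortment produce it.

A consistent vector for `A` therefore has a level that can be compared with the levels of the data.
Exceedance decreases in the level and the data decrease along the chain, so the vector lies below
the data of the first `k` assortments and above the rest (`exists_mem_sandwichRegion`). By the same
monotonicity of the data, this region is the feasible set of the `k`-th program.

Conversely, let `x` be feasible for some `k`. After possibly lowering `k`, the levels of the two
groups are strictly separated (`exists_separated_sandwichRegion`). For each `i ∈ A` some level
strictly between those that constrain `i` has exceedance probability close to `x i`. An increasing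
change of utility scale, one per product, fixes the data levels and carries all these levels to a
common `s`. Shifting `s` until the probabilities sum to one gives a consistent vector near `x`
(`exists_mem_consistentSet_near`). Consistent vectors are thus dense enough in the feasible regions
for the infima to agree; compactness gives minimizers of the programs. -/

namespace MDM

variable {n : ℕ} (M : MDM n)

/-! ### Exceedance probabilities as functions of an extended real level. -/

instance (i : Fin n) : IsProbabilityMeasure (M.μ i) := M.isProbabilityMeasure i

/-- The shocks of product `i` for which its utility exceeds the level `l`. -/
def exceedSet (i : Fin n) (l : EReal) : Set ℝ := {t | l < ((M.ν i + t : ℝ) : EReal)}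

/-- The probability that the utility of product `i` exceeds the level `l`. -/
noncomputable def exceedProb (i : Fin n) (l : EReal) : ℝ := (M.μ i).real (M.exceedSet i l)

theorem isOpen_exceedSet (i : Fin n) (l : EReal) : IsOpen (M.exceedSet i l) :=
  isOpen_lt continuous_const (continuous_coe_real_ereal.comp (by fun_prop))

theorem measurableSet_exceedSet (i : Fin n) (l : EReal) : MeasurableSet (M.exceedSet i l) :=
  (M.isOpen_exceedSet i l).measurableSet

theorem exceedProb_nonneg (i : Fin n) (l : EReal) : 0 ≤ M.exceedProb i l := measureReal_nonneg

@[simp]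
theorem exceedProb_bot (i : Fin n) : M.exceedProb i ⊥ = 1 := by
  have : M.exceedSet i ⊥ = Set.univ := by ext t; simp [exceedSet, EReal.bot_lt_coe, -EReal.coe_add]
  simp [exceedProb, this]

@[simp]
theorem exceedProb_top (i : Fin n) : M.exceedProb i ⊤ = 0 := by
  have : M.exceedSet i ⊤ = ∅ := by ext t; simp [exceedSet]
  simp [exceedProb, this]

theorem antitone_exceedProb (i : Fin n) : Antitone (M.exceedProb i) := fun _ _ h =>
  measureReal_mono fun _ ht => lt_of_le_of_lt h ht

theorem measure_singleton_eq_zero (i : Fin n) (t : ℝ) : M.μ i {t} = 0 :=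
  M.absolutelyContinuous i (by simp)

/-- The law has no atoms, so the indicator of the exceedance event is continuous in the level at `l`
for almost every shock; dominated convergence applies, also at infinite levels. -/
theorem continuous_exceedProb (i : Fin n) : Continuous (M.exceedProb i) := by
  have hG : M.exceedProb i = fun l => ∫ t, (M.exceedSet i l).indicator (fun _ => (1 : ℝ)) t ∂M.μ i := by
    funext l
    rw [integral_indicator (M.measurableSet_exceedSet i l)]
    simp [exceedProb, measureReal_def]
  rw [hG, continuous_iff_continuousAt]
  intro l
  refine continuousAt_of_dominated (bound := fun _ => 1) ?_ ?_ (integrable_const _) ?_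
  · exact Filter.Eventually.of_forall fun x =>
      ((measurable_const.indicator (M.measurableSet_exceedSet i x))).aestronglyMeasurable
  · refine Filter.Eventually.of_forall fun x => Filter.Eventually.of_forall fun t => ?_
    by_cases h : t ∈ M.exceedSet i x <;> simp [h]
  · have hne : ∀ᵐ t ∂M.μ i, t ≠ l.toReal - M.ν i := by
      rw [ae_iff]
      simpa using M.measure_singleton_eq_zero i (l.toReal - M.ν i)
    filter_upwards [hne] with t ht
    have hne' : ((M.ν i + t : ℝ) : EReal) ≠ l := by
      rintro rfl
      apply ht
      rw [EReal.toReal_coe]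
      ring
    rcases lt_or_gt_of_ne hne' with h | h
    · refine (continuousAt_const (y := (0 : ℝ))).congr ?_
      filter_upwards [lt_mem_nhds h] with x hx
      have : t ∉ M.exceedSet i x := not_lt.2 hx.le
      simp [this]
    · refine (continuousAt_const (y := (1 : ℝ))).congr ?_
      filter_upwards [gt_mem_nhds h] with x hx
      have : t ∈ M.exceedSet i x := hx
      simp [this]

/-- Every level between the two extreme ones is attained by the total exceedance probability. -/
theorem exists_sum_exceedProb_eq_one {S : Finset (Fin n)} (hS : S.Nonempty) :
    ∃ l, ∑ i ∈ S, M.exceedProb i l = 1 := by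
  have hc : Continuous fun l => ∑ i ∈ S, M.exceedProb i l :=
    continuous_finsetSum _ fun i _ => M.continuous_exceedProb i
  have h := intermediate_value_univ (⊤ : EReal) ⊥ hc
  refine h ⟨by simp, ?_⟩
  simpa using hS

/-! ### The dual bound on the expected maximal utility. -/

variable {M}

theorem integrable_utility {θ : Measure (Fin n → ℝ)} (h : θ ∈ M.jointLaws) (i : Fin n) :
    Integrable (fun ε : Fin n → ℝ => M.ν i + ε i) θ := by
  have := h.1
  have h1 : Integrable (fun t : ℝ => t) (θ.map fun ε => ε i) := by
    rw [h.2 i]; exact M.integrable i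
  exact (integrable_const _).add (h1.comp_measurable (measurable_pi_apply i))

theorem exists_eq_iSup_utility (M : MDM n) {S : Finset (Fin n)} (hS : S.Nonempty) (ε : Fin n → ℝ) :
    ∃ k ∈ S, (⨆ i : {i // i ∈ S}, (M.ν i + ε i)) = M.ν k + ε k := by
  have : Nonempty {i // i ∈ S} := hS.to_subtype
  obtain ⟨k, hk⟩ := exists_eq_ciSup_of_finite (f := fun i : {i // i ∈ S} => M.ν i + ε i)
  exact ⟨k, k.2, hk.symm⟩

theorem le_iSup_utility (M : MDM n) {S : Finset (Fin n)} (ε : Fin n → ℝ) {k : Fin n} (hk : k ∈ S) :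
    M.ν k + ε k ≤ ⨆ i : {i // i ∈ S}, (M.ν i + ε i) :=
  le_ciSup (f := fun i : {i // i ∈ S} => M.ν i + ε i) (Set.finite_range _).bddAbove ⟨k, hk⟩

theorem integrable_iSup_utility {θ : Measure (Fin n → ℝ)} (h : θ ∈ M.jointLaws)
    {S : Finset (Fin n)} (hS : S.Nonempty) :
    Integrable (fun ε : Fin n → ℝ => ⨆ i : {i // i ∈ S}, (M.ν i + ε i)) θ := by
  refine Integrable.mono' (g := fun ε => ∑ i ∈ S, |M.ν i + ε i|)
    (integrable_finsetSum _ fun i _ => (integrable_utility h i).abs) ?_ ?_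
  · exact (Measurable.iSup fun i => by fun_prop).aestronglyMeasurable
  · refine Filter.Eventually.of_forall fun ε => ?_
    obtain ⟨k, hk, he⟩ := M.exists_eq_iSup_utility hS ε
    rw [he, Real.norm_eq_abs]
    exact Finset.single_le_sum (f := fun i => |M.ν i + ε i|) (fun i _ => abs_nonneg _) hk

theorem measure_preimage_of_mem_jointLaws {θ : Measure (Fin n → ℝ)} (h : θ ∈ M.jointLaws)
    (i : Fin n) {s : Set ℝ} (hs : MeasurableSet s) : θ {ε | ε i ∈ s} = M.μ i s := by
  rw [← h.2 i, Measure.map_apply (measurable_pi_apply i) hs]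
  rfl

/-- The dual objective whose minimum over `l` is the extremal expected maximal utility. -/
noncomputable def dualBound (M : MDM n) (S : Finset (Fin n)) (l : ℝ) : ℝ :=
  l + ∑ i ∈ S, ∫ t, max (M.ν i + t - l) 0 ∂M.μ i

theorem integrable_excess {θ : Measure (Fin n → ℝ)} (h : θ ∈ M.jointLaws) (l : ℝ) (i : Fin n) :
    Integrable (fun ε : Fin n → ℝ => max (M.ν i + ε i - l) 0) θ := by
  have := h.1
  exact ((integrable_utility h i).sub (integrable_const l)).pos_part

theorem integral_excess {θ : Measure (Fin n → ℝ)} (h : θ ∈ M.jointLaws) (S : Finset (Fin n))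
    (l : ℝ) : ∫ ε, (l + ∑ i ∈ S, max (M.ν i + ε i - l) 0) ∂θ = M.dualBound S l := by
  have := h.1
  rw [integral_add (integrable_const _)
    (integrable_finsetSum _ fun i _ => integrable_excess h l i),
    integral_finsetSum _ fun i _ => integrable_excess h l i]
  simp only [integral_const, probReal_univ, one_smul, dualBound]
  congr 1
  refine Finset.sum_congr rfl fun i _ => ?_
  rw [← h.2 i, integral_map (measurable_pi_apply i).aemeasurable
    (by fun_prop)]

theorem iSup_utility_le (M : MDM n) {S : Finset (Fin n)} (hS : S.Nonempty) (l : ℝ)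
    (ε : Fin n → ℝ) :
    (⨆ i : {i // i ∈ S}, (M.ν i + ε i)) ≤ l + ∑ i ∈ S, max (M.ν i + ε i - l) 0 := by
  obtain ⟨k, hk, he⟩ := M.exists_eq_iSup_utility hS ε
  rw [he]
  have h1 := Finset.single_le_sum (f := fun i => max (M.ν i + ε i - l) 0)
    (fun i _ => le_max_right _ _) hk
  have h2 := le_max_left (M.ν k + ε k - l) 0
  linarith

theorem expectedMaxUtility_le_dualBound {θ : Measure (Fin n → ℝ)} (h : θ ∈ M.jointLaws)
    {S : Finset (Fin n)} (hS : S.Nonempty) (l : ℝ) :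
    M.expectedMaxUtility S θ ≤ M.dualBound S l := by
  have := h.1
  rw [← integral_excess h S l]
  exact integral_mono (integrable_iSup_utility h hS)
    ((integrable_const _).add (integrable_finsetSum _ fun i _ => integrable_excess h l i))
    (M.iSup_utility_le hS l)

/-- The pointwise gap in `iSup_utility_le` is nonnegative, so its integral vanishes only if the gap
vanishes almost everywhere. -/
theorem expectedMaxUtility_eq_dualBound_iff {θ : Measure (Fin n → ℝ)} (h : θ ∈ M.jointLaws)
    {S : Finset (Fin n)} (hS : S.Nonempty) (l : ℝ) :
    M.expectedMaxUtility S θ = M.dualBound S l ↔ ∀ᵐ ε ∂θ,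
      (⨆ i : {i // i ∈ S}, (M.ν i + ε i)) = l + ∑ i ∈ S, max (M.ν i + ε i - l) 0 := by
  have := h.1
  rw [← integral_excess h S l]
  exact integral_eq_iff_of_ae_le (integrable_iSup_utility h hS)
    ((integrable_const _).add (integrable_finsetSum _ fun i _ => integrable_excess h l i))
    (Filter.Eventually.of_forall (M.iSup_utility_le hS l))

/-- If the dual bound is tight at `ε`, at most one product exceeds the level `l`. -/
theorem eq_of_iSup_utility_eq {S : Finset (Fin n)} (hS : S.Nonempty) {l : ℝ} {ε : Fin n → ℝ}
    (h : (⨆ i : {i // i ∈ S}, (M.ν i + ε i)) = l + ∑ i ∈ S, max (M.ν i + ε i - l) 0)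
    {i j : Fin n} (hi : i ∈ S) (hj : j ∈ S) (hli : l < M.ν i + ε i) (hlj : l < M.ν j + ε j) :
    i = j := by
  obtain ⟨k, hk, he⟩ := M.exists_eq_iSup_utility hS ε
  have key : ∀ a ∈ S, l < M.ν a + ε a → a = k := by
    intro a ha hla
    by_contra hak
    rw [he, ← Finset.add_sum_erase _ _ hk] at h
    have h1 := Finset.single_le_sum (f := fun i => max (M.ν i + ε i - l) 0)
      (fun i _ => le_max_right _ _) (Finset.mem_erase.2 ⟨hak, ha⟩)
    have h2 := le_max_left (M.ν k + ε k - l) 0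
    have h3 := le_max_left (M.ν a + ε a - l) 0
    linarith
  rw [key i hi hli, key j hj hlj]

/-- If exactly one product exceeds the level `l`, the dual bound is tight. -/
theorem iSup_utility_eq {S : Finset (Fin n)} (hS : S.Nonempty) {l : ℝ} {ε : Fin n → ℝ}
    {k : Fin n} (hk : k ∈ S) (h : ∀ j ∈ S, l < M.ν j + ε j ↔ j = k) :
    (⨆ i : {i // i ∈ S}, (M.ν i + ε i)) = l + ∑ i ∈ S, max (M.ν i + ε i - l) 0 := by
  refine le_antisymm (M.iSup_utility_le hS l ε) ?_
  have hlk := (h k hk).2 rfl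
  rw [Finset.sum_eq_single_of_mem k hk, max_eq_left (by linarith)]
  · have := M.le_iSup_utility ε hk
    linarith
  · intro j hj hjk
    exact max_eq_right (by linarith [not_lt.1 (fun hl => hjk ((h j hj).1 hl))])

end MDM

/-! ### The extremal coupling; choice probabilities as exceedance probabilities. -/

namespace MDM

variable {n : ℕ} (M : MDM n)

/-- The law of the shock of product `j` conditional on `i` being the product of `S` that exceeds
the level `l`, in the extremal joint law. -/
noncomputable def conditionalMarginal (S : Finset (Fin n)) (l : EReal) (i j : Fin n) : Measure ℝ :=
  if j ∉ S then M.μ j else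
    if j = i then ProbabilityTheory.cond (M.μ j) (M.exceedSet j l)
    else ProbabilityTheory.cond (M.μ j) (M.exceedSet j l)ᶜ

/-- The mixture over `i ∈ S` of the product laws under which exactly product `i` exceeds `l`. -/
noncomputable def extremalLaw (S : Finset (Fin n)) (l : EReal) : Measure (Fin n → ℝ) :=
  ∑ i ∈ S, M.μ i (M.exceedSet i l) • Measure.pi (M.conditionalMarginal S l i)

variable {M}

theorem sum_measure_exceedSet {S : Finset (Fin n)} {l : EReal}
    (h : ∑ i ∈ S, M.exceedProb i l = 1) : ∑ i ∈ S, M.μ i (M.exceedSet i l) = 1 := by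
  have h1 : ∑ i ∈ S, M.μ i (M.exceedSet i l) = ENNReal.ofReal (∑ i ∈ S, M.exceedProb i l) := by
    rw [ENNReal.ofReal_sum_of_nonneg fun i _ => M.exceedProb_nonneg i l]
    exact Finset.sum_congr rfl fun i _ => (ofReal_measureReal (measure_ne_top _ _)).symm
  rw [h1, h, ENNReal.ofReal_one]

/-- The mixture weights of the products other than `j` add up to the mass that `μ j` leaves below
the level. This is what gives the mixture the right `j`-th marginal. -/
theorem sum_erase_measure_exceedSet {S : Finset (Fin n)} {l : EReal}
    (h : ∑ i ∈ S, M.exceedProb i l = 1) {j : Fin n} (hj : j ∈ S) :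
    ∑ i ∈ S.erase j, M.μ i (M.exceedSet i l) = M.μ j (M.exceedSet j l)ᶜ := by
  have h1 := sum_measure_exceedSet h
  rw [← Finset.add_sum_erase _ _ hj, ← prob_add_prob_compl (μ := M.μ j)
    (M.measurableSet_exceedSet j l)] at h1
  exact (ENNReal.add_right_inj (measure_ne_top _ _)).1 h1

theorem isProbabilityMeasure_conditionalMarginal {S : Finset (Fin n)} {l : EReal}
    (h : ∑ i ∈ S, M.exceedProb i l = 1) {i : Fin n} (hi : i ∈ S)
    (hc : M.μ i (M.exceedSet i l) ≠ 0) (j : Fin n) :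
    IsProbabilityMeasure (M.conditionalMarginal S l i j) := by
  unfold conditionalMarginal
  split_ifs with h1 h2
  rotate_right
  · infer_instance
  · subst h2
    exact ProbabilityTheory.cond_isProbabilityMeasure hc
  · refine ProbabilityTheory.cond_isProbabilityMeasure ?_
    rw [← sum_erase_measure_exceedSet h h1]
    intro h0
    exact hc (Finset.sum_eq_zero_iff.1 h0 i (Finset.mem_erase.2 ⟨fun e => h2 e.symm, hi⟩))

theorem extremalLaw_map_eval {S : Finset (Fin n)} {l : EReal}
    (h : ∑ i ∈ S, M.exceedProb i l = 1) (j : Fin n) :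
    (M.extremalLaw S l).map (fun ε => ε j) = M.μ j := by
  ext s hs
  rw [Measure.map_apply (measurable_pi_apply j) hs, extremalLaw, Measure.finsetSum_apply]
  have h1 : ∀ i ∈ S, (M.μ i (M.exceedSet i l) • Measure.pi (M.conditionalMarginal S l i))
      ((fun ε : Fin n → ℝ => ε j) ⁻¹' s)
      = M.μ i (M.exceedSet i l) * M.conditionalMarginal S l i j s := by
    intro i hi
    rw [Measure.smul_apply, smul_eq_mul]
    by_cases hc : M.μ i (M.exceedSet i l) = 0
    · simp [hc]
    · have := isProbabilityMeasure_conditionalMarginal h hi hc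
      rw [← (measurePreserving_eval (M.conditionalMarginal S l i) j).measure_preimage
        hs.nullMeasurableSet]
  rw [Finset.sum_congr rfl h1]
  -- For `j ∈ S`, the component in which `j` wins contributes `μ j` restricted to the exceedance
  -- set, and the other components together contribute the restriction to its complement.
  by_cases hj : j ∈ S
  · rw [← Finset.add_sum_erase _ _ hj]
    have h2 : ∀ i ∈ S.erase j, M.μ i (M.exceedSet i l) * M.conditionalMarginal S l i j s
        = M.μ i (M.exceedSet i l) * ProbabilityTheory.cond (M.μ j) (M.exceedSet j l)ᶜ s := by
      intro i hi
      have : j ≠ i := (Finset.ne_of_mem_erase hi).symm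
      simp [conditionalMarginal, hj, this]
    rw [Finset.sum_congr rfl h2, ← Finset.sum_mul, sum_erase_measure_exceedSet h hj]
    have h3 : M.conditionalMarginal S l j j = ProbabilityTheory.cond (M.μ j) (M.exceedSet j l) := by
      simp [conditionalMarginal, hj]
    rw [h3, mul_comm, ProbabilityTheory.cond_mul_eq_inter (M.measurableSet_exceedSet j l), mul_comm,
      ProbabilityTheory.cond_mul_eq_inter (M.measurableSet_exceedSet j l).compl,
      Set.inter_comm, Set.inter_comm _ s]
    exact measure_inter_add_sdiff s (M.measurableSet_exceedSet j l)
  · have h2 : ∀ i ∈ S, M.μ i (M.exceedSet i l) * M.conditionalMarginal S l i j s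
        = M.μ i (M.exceedSet i l) * M.μ j s := by
      intro i _
      simp [conditionalMarginal, hj]
    rw [Finset.sum_congr rfl h2, ← Finset.sum_mul, sum_measure_exceedSet h, one_mul]

theorem extremalLaw_mem_jointLaws {S : Finset (Fin n)} {l : EReal}
    (h : ∑ i ∈ S, M.exceedProb i l = 1) : M.extremalLaw S l ∈ M.jointLaws := by
  refine ⟨⟨?_⟩, extremalLaw_map_eval h⟩
  rw [extremalLaw, Measure.finsetSum_apply, ← sum_measure_exceedSet h]
  refine Finset.sum_congr rfl fun i hi => ?_
  rw [Measure.smul_apply, smul_eq_mul]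
  by_cases hc : M.μ i (M.exceedSet i l) = 0
  · simp [hc]
  · have := isProbabilityMeasure_conditionalMarginal h hi hc
    rw [measure_univ, mul_one]

theorem ae_extremalLaw {S : Finset (Fin n)} {l : EReal} (h : ∑ i ∈ S, M.exceedProb i l = 1) :
    ∀ᵐ ε ∂M.extremalLaw S l, ∃ i ∈ S, ∀ j ∈ S, ε j ∈ M.exceedSet j l ↔ j = i := by
  rw [extremalLaw, ae_finsetSum_measure_iff]
  intro i hi
  by_cases hc : M.μ i (M.exceedSet i l) = 0
  · simp [hc]
  refine Measure.ae_smul_measure ?_ _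
  have := isProbabilityMeasure_conditionalMarginal h hi hc
  have key : ∀ j, ∀ᵐ ε ∂Measure.pi (M.conditionalMarginal S l i),
      j ∈ S → (ε j ∈ M.exceedSet j l ↔ j = i) := by
    intro j
    refine (measurePreserving_eval (M.conditionalMarginal S l i) j).quasiMeasurePreserving.ae
      (p := fun t => j ∈ S → (t ∈ M.exceedSet j l ↔ j = i)) ?_
    by_cases hj : j ∈ S
    · by_cases hji : j = i
      · have : M.conditionalMarginal S l i j = ProbabilityTheory.cond (M.μ j) (M.exceedSet j l) := by
          simp [conditionalMarginal, hj, ← hji]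
        rw [this]
        filter_upwards [ProbabilityTheory.ae_cond_mem (M.measurableSet_exceedSet j l)] with t ht _
        exact ⟨fun _ => hji, fun _ => ht⟩
      · have : M.conditionalMarginal S l i j
            = ProbabilityTheory.cond (M.μ j) (M.exceedSet j l)ᶜ := by
          simp [conditionalMarginal, hj, hji]
        rw [this]
        filter_upwards [ProbabilityTheory.ae_cond_mem (M.measurableSet_exceedSet j l).compl]
          with t ht _
        simpa [hji] using ht
    · simp [hj]
  filter_upwards [ae_all_iff.2 key] with ε hε
  exact ⟨i, hi, hε⟩

theorem isExtremal_extremalLaw {S : Finset (Fin n)} (hS : S.Nonempty) {l : ℝ}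
    (h : ∑ i ∈ S, M.exceedProb i l = 1) : M.IsExtremal S (M.extremalLaw S l) ∧
      M.expectedMaxUtility S (M.extremalLaw S l) = M.dualBound S l := by
  have hj := extremalLaw_mem_jointLaws h
  have he : M.expectedMaxUtility S (M.extremalLaw S l) = M.dualBound S l := by
    rw [expectedMaxUtility_eq_dualBound_iff hj hS]
    filter_upwards [ae_extremalLaw h] with ε hε
    obtain ⟨i, hi, hε⟩ := hε
    exact iSup_utility_eq hS hi fun j hjS => by
      rw [← hε j hjS, exceedSet, Set.mem_ofPred_eq, EReal.coe_lt_coe_iff]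
  exact ⟨⟨hj, fun θ hθ => he ▸ expectedMaxUtility_le_dualBound hθ hS l⟩, he⟩

/-- Tightness of the dual bound makes the exceedance events almost surely disjoint. Their
probabilities sum to one, so almost surely exactly one product exceeds the level, and that product
is the unique maximizer. -/
theorem IsExtremal.argmax_eq_exceedProb {S : Finset (Fin n)} (hS : S.Nonempty) {l : ℝ}
    (h : ∑ i ∈ S, M.exceedProb i l = 1) {θ : Measure (Fin n → ℝ)} (hθ : M.IsExtremal S θ)
    {i : Fin n} (hi : i ∈ S) : θ.real (M.argmaxEvent S i) = M.exceedProb i l := by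
  have := hθ.1.1
  obtain ⟨h0, he⟩ := isExtremal_extremalLaw hS h
  have hopt : M.expectedMaxUtility S θ = M.dualBound S l :=
    le_antisymm (expectedMaxUtility_le_dualBound hθ.1 hS l) (he ▸ hθ.2 _ h0.1)
  have htight := (expectedMaxUtility_eq_dualBound_iff hθ.1 hS l).1 hopt
  have hm : ∀ j, MeasurableSet {ε : Fin n → ℝ | ε j ∈ M.exceedSet j l} := fun j =>
    measurable_pi_apply j (M.measurableSet_exceedSet j l)
  have hmem : ∀ (ε : Fin n → ℝ) j, ε j ∈ M.exceedSet j l ↔ l < M.ν j + ε j := fun ε j => by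
    rw [exceedSet, Set.mem_ofPred_eq, EReal.coe_lt_coe_iff]
  have huniq : ∀ᵐ ε ∂θ, ∀ j ∈ S, ∀ k ∈ S, ε j ∈ M.exceedSet j l → ε k ∈ M.exceedSet k l →
      j = k := by
    filter_upwards [htight] with ε hε j hj k hk h1 h2
    exact eq_of_iSup_utility_eq hS hε hj hk ((hmem ε j).1 h1) ((hmem ε k).1 h2)
  have hex : ∀ᵐ ε ∂θ, ε ∈ ⋃ j ∈ S, {ε : Fin n → ℝ | ε j ∈ M.exceedSet j l} := by
    have hU : NullMeasurableSet (⋃ j ∈ S, {ε : Fin n → ℝ | ε j ∈ M.exceedSet j l}) θ :=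
      (Finset.measurableSet_biUnion _ fun j _ => hm j).nullMeasurableSet
    have : θ (⋃ j ∈ S, {ε : Fin n → ℝ | ε j ∈ M.exceedSet j l}) = 1 := by
      rw [measure_biUnion_finset₀ _ fun j _ => (hm j).nullMeasurableSet]
      · rw [← sum_measure_exceedSet h]
        exact Finset.sum_congr rfl fun j _ =>
          measure_preimage_of_mem_jointLaws hθ.1 j (M.measurableSet_exceedSet j l)
      · intro j hj k hk hjk
        rw [Function.onFun, AEDisjoint, measure_eq_zero_iff_ae_notMem]
        filter_upwards [huniq] with ε hε hjk'
        exact hjk (hε j hj k hk hjk'.1 hjk'.2)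
    exact (mem_ae_iff_prob_eq_one₀ hU).2 this
  have hcongr : M.argmaxEvent S i =ᵐ[θ] {ε : Fin n → ℝ | ε i ∈ M.exceedSet i l} := by
    rw [Filter.eventuallyEq_set]
    filter_upwards [huniq, hex] with ε h1 h2
    simp only [Set.mem_iUnion, Set.mem_ofPred_eq, exists_prop] at h2
    obtain ⟨k, hk, hεk⟩ := h2
    constructor
    · intro harg
      exact (hmem ε i).2 (lt_of_lt_of_le ((hmem ε k).1 hεk) (harg k hk))
    · intro hεi j hj
      by_contra hlt
      have hεj : ε j ∈ M.exceedSet j l :=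
        (hmem ε j).2 (((hmem ε i).1 hεi).trans (not_le.1 hlt))
      have := h1 j hj i hi hεj hεi
      subst this
      exact hlt le_rfl
  rw [measureReal_congr hcongr, exceedProb, measureReal_def, measureReal_def,
    measure_preimage_of_mem_jointLaws hθ.1 i (M.measurableSet_exceedSet i l)]

/-- Covers the level `⊥`, where the duality argument with a real level is unavailable. -/
theorem isExtremal_singleton {i : Fin n} {θ : Measure (Fin n → ℝ)} (hθ : θ ∈ M.jointLaws) :
    M.IsExtremal {i} θ := by
  refine ⟨hθ, fun θ' hθ' => le_of_eq ?_⟩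
  have key : ∀ θ ∈ M.jointLaws, M.expectedMaxUtility {i} θ = ∫ t, M.ν i + t ∂M.μ i := by
    intro θ hθ
    rw [← hθ.2 i, integral_map (measurable_pi_apply i).aemeasurable (by fun_prop)]
    refine integral_congr_ae (Filter.Eventually.of_forall fun ε => ?_)
    obtain ⟨k, hk, he⟩ := M.exists_eq_iSup_utility (Finset.singleton_nonempty i) ε
    rw [Finset.mem_singleton] at hk
    subst hk
    exact he
  rw [key θ hθ, key θ' hθ']

/-- The choice probabilities are exceedance probabilities of a common level. -/
theorem generates_iff_of_sum_eq_one {S : Finset (Fin n)} (hS : S.Nonempty) {l : EReal}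
    (h : ∑ i ∈ S, M.exceedProb i l = 1) {q : Fin n → ℝ} :
    M.Generates S q ↔ ∀ i ∈ S, q i = M.exceedProb i l := by
  suffices H : (∃ θ, M.IsExtremal S θ) ∧ ∀ θ, M.IsExtremal S θ → ∀ i ∈ S,
      θ.real (M.argmaxEvent S i) = M.exceedProb i l by
    constructor
    · rintro ⟨θ, hθ, hq⟩ i hi
      rw [hq i hi, H.2 θ hθ i hi]
    · intro hq
      obtain ⟨θ, hθ⟩ := H.1
      exact ⟨θ, hθ, fun i hi => by rw [hq i hi, H.2 θ hθ i hi]⟩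
  induction l with
  | bot =>
    -- At `⊥` every exceedance probability is one, so a total of one forces a single product.
    have hc : S.card = 1 := by simpa using h
    obtain ⟨i, rfl⟩ := Finset.card_eq_one.1 hc
    refine ⟨⟨_, isExtremal_singleton (extremalLaw_mem_jointLaws h)⟩, fun θ hθ j hj => ?_⟩
    rw [Finset.mem_singleton] at hj
    subst hj
    have := hθ.1.1
    have : M.argmaxEvent {j} j = Set.univ := by ext ε; simp [argmaxEvent]
    simp [this]
  | top => simp at h
  | coe l => exact ⟨⟨_, (isExtremal_extremalLaw hS h).1⟩, fun θ hθ i hi =>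
      hθ.argmax_eq_exceedProb hS h hi⟩

theorem generates_iff {S : Finset (Fin n)} (hS : S.Nonempty) {q : Fin n → ℝ} :
    M.Generates S q ↔
      ∃ l, ∑ i ∈ S, M.exceedProb i l = 1 ∧ ∀ i ∈ S, q i = M.exceedProb i l := by
  constructor
  · intro h
    obtain ⟨l, hl⟩ := M.exists_sum_exceedProb_eq_one hS
    exact ⟨l, hl, (generates_iff_of_sum_eq_one hS hl).1 h⟩
  · rintro ⟨l, hl, h⟩
    exact (generates_iff_of_sum_eq_one hS hl).2 h

end MDM

/-! ### Increasing bi-Lipschitz maps of the line. -/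

/-- `f` is increasing, with difference quotients bounded above and bounded away from zero. -/
def HasBoundedSlopes (f : ℝ → ℝ) : Prop :=
  ∃ c K : ℝ, 0 < c ∧ ∀ x y, x ≤ y → c * (y - x) ≤ f y - f x ∧ f y - f x ≤ K * (y - x)

namespace HasBoundedSlopes

variable {f g : ℝ → ℝ}

theorem affine {k : ℝ} (hk : 0 < k) (a b : ℝ) : HasBoundedSlopes fun y => b + k * (y - a) :=
  ⟨k, k, hk, fun x y _ => ⟨by linarith, by linarith⟩⟩

theorem id : HasBoundedSlopes fun y => y :=
  ⟨1, 1, one_pos, fun x y _ => ⟨by linarith, by linarith⟩⟩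

theorem exists_common (hf : HasBoundedSlopes f) (hg : HasBoundedSlopes g) :
    ∃ c K : ℝ, 0 < c ∧ ∀ x y, x ≤ y → (c * (y - x) ≤ f y - f x ∧ f y - f x ≤ K * (y - x)) ∧
      (c * (y - x) ≤ g y - g x ∧ g y - g x ≤ K * (y - x)) := by
  obtain ⟨c, K, hc, h⟩ := hf
  obtain ⟨c', K', hc', h'⟩ := hg
  refine ⟨min c c', max K K', lt_min hc hc', fun x y hxy => ?_⟩
  have hd : 0 ≤ y - x := sub_nonneg.2 hxy
  have h1 := mul_le_mul_of_nonneg_right (min_le_left c c') hd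
  have h2 := mul_le_mul_of_nonneg_right (min_le_right c c') hd
  have h3 := mul_le_mul_of_nonneg_right (le_max_left K K') hd
  have h4 := mul_le_mul_of_nonneg_right (le_max_right K K') hd
  have := h x y hxy
  have := h' x y hxy
  refine ⟨⟨?_, ?_⟩, ?_, ?_⟩ <;> linarith

theorem max (hf : HasBoundedSlopes f) (hg : HasBoundedSlopes g) :
    HasBoundedSlopes fun y => max (f y) (g y) := by
  obtain ⟨c, K, hc, h⟩ := exists_common hf hg
  refine ⟨c, K, hc, fun x y hxy => ?_⟩
  obtain ⟨⟨h1, h2⟩, h3, h4⟩ := h x y hxy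
  constructor
  · have : Max.max (f x) (g x) ≤ Max.max (f y) (g y) - c * (y - x) :=
      max_le (by linarith [le_max_left (f y) (g y)]) (by linarith [le_max_right (f y) (g y)])
    linarith
  · have : Max.max (f y) (g y) ≤ Max.max (f x) (g x) + K * (y - x) :=
      max_le (by linarith [le_max_left (f x) (g x)]) (by linarith [le_max_right (f x) (g x)])
    linarith

theorem min (hf : HasBoundedSlopes f) (hg : HasBoundedSlopes g) :
    HasBoundedSlopes fun y => min (f y) (g y) := by
  obtain ⟨c, K, hc, h⟩ := exists_common hf hg
  refine ⟨c, K, hc, fun x y hxy => ?_⟩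
  obtain ⟨⟨h1, h2⟩, h3, h4⟩ := h x y hxy
  constructor
  · have : Min.min (f x) (g x) + c * (y - x) ≤ Min.min (f y) (g y) :=
      le_min (by linarith [min_le_left (f x) (g x)]) (by linarith [min_le_right (f x) (g x)])
    linarith
  · have : Min.min (f y) (g y) - K * (y - x) ≤ Min.min (f x) (g x) :=
      le_min (by linarith [min_le_left (f y) (g y)]) (by linarith [min_le_right (f y) (g y)])
    linarith

theorem exists_abs_sub_le (hf : HasBoundedSlopes f) :
    ∃ c K : ℝ, 0 < c ∧ 0 ≤ K ∧ ∀ x y, c * |y - x| ≤ |f y - f x| ∧ |f y - f x| ≤ K * |y - x| := by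
  obtain ⟨c, K, hc, h⟩ := hf
  have hK : c ≤ K := by have := h 0 1 zero_le_one; linarith
  refine ⟨c, K, hc, hc.le.trans hK, ?_⟩
  have key : ∀ x y, x ≤ y → c * |y - x| ≤ |f y - f x| ∧ |f y - f x| ≤ K * |y - x| := by
    intro x y hxy
    have hd : 0 ≤ y - x := sub_nonneg.2 hxy
    have hfd : 0 ≤ f y - f x := (mul_nonneg hc.le hd).trans (h x y hxy).1
    rw [abs_of_nonneg hd, abs_of_nonneg hfd]
    exact h x y hxy
  intro x y
  rcases le_total x y with hxy | hxy
  · exact key x y hxy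
  · rw [abs_sub_comm y x, abs_sub_comm (f y) (f x)]
    exact key y x hxy

theorem strictMono (hf : HasBoundedSlopes f) : StrictMono f := by
  obtain ⟨c, K, hc, h⟩ := hf
  intro x y hxy
  have := (h x y hxy.le).1
  have := mul_pos hc (sub_pos.2 hxy)
  linarith

theorem continuous (hf : HasBoundedSlopes f) : Continuous f := by
  obtain ⟨c, K, hc, hK, h⟩ := hf.exists_abs_sub_le
  refine (LipschitzWith.of_dist_le_mul (K := K.toNNReal) fun x y => ?_).continuous
  rw [Real.coe_toNNReal K hK, Real.dist_eq, Real.dist_eq]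
  exact (h y x).2

theorem antilipschitz (hf : HasBoundedSlopes f) : ∃ K, AntilipschitzWith K f := by
  obtain ⟨c, K, hc, hK, h⟩ := hf.exists_abs_sub_le
  refine ⟨c⁻¹.toNNReal, AntilipschitzWith.of_le_mul_dist fun x y => ?_⟩
  rw [Real.coe_toNNReal _ (inv_nonneg.2 hc.le), Real.dist_eq, Real.dist_eq, inv_mul_eq_div,
    le_div_iff₀ hc, mul_comm]
  exact (h y x).1

theorem surjective (hf : HasBoundedSlopes f) : Function.Surjective f := by
  obtain ⟨c, K, hc, h⟩ := show HasBoundedSlopes f from hf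
  refine hf.continuous.surjective ?_ ?_
  · refine Filter.tendsto_atTop_mono' _ (f₁ := fun y => f 0 + c * y) ?_ ?_
    · filter_upwards [Filter.eventually_ge_atTop 0] with y hy
      have := (h 0 y hy).1
      rw [sub_zero] at this
      linarith
    · exact Filter.tendsto_atTop_add_const_left _ _ (Filter.tendsto_id.const_mul_atTop hc)
  · refine Filter.tendsto_atBot_mono' _ (f₁ := fun y => f 0 + c * y) ?_ ?_
    · filter_upwards [Filter.eventually_le_atBot 0] with y hy
      have := (h y 0 hy).1
      rw [zero_sub] at this
      linarith
    · exact Filter.tendsto_atBot_add_const_left _ _ (Filter.tendsto_id.const_mul_atBot hc)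

/-- The lower slope bound makes `f` antilipschitz, so a preimage has at most a constant times the
one-dimensional Hausdorff measure, which is Lebesgue measure. It keeps transformed laws absolutely
continuous. -/
theorem volume_preimage_eq_zero (hf : HasBoundedSlopes f) {s : Set ℝ} (hs : volume s = 0) :
    volume (f ⁻¹' s) = 0 := by
  obtain ⟨K, hK⟩ := hf.antilipschitz
  have := hK.hausdorffMeasure_preimage_le zero_le_one s
  rw [hausdorffMeasure_real, hs, mul_zero] at this
  exact le_antisymm this zero_le

/-- A piecewise affine map that fixes everything outside `(a, b)` and moves `t` to `s`. -/
theorem exists_map_eq {a b s t : ℝ} (hat : a < t) (htb : t < b) (has : a < s) (hsb : s < b) :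
    ∃ f, HasBoundedSlopes f ∧ f t = s ∧ (∀ y ≤ a, f y = y) ∧ ∀ y, b ≤ y → f y = y := by
  have hta : 0 < t - a := sub_pos.2 hat
  have hbt : 0 < b - t := sub_pos.2 htb
  have hsa : 0 < s - a := sub_pos.2 has
  have hbs : 0 < b - s := sub_pos.2 hsb
  have hk1 : 0 < (s - a) / (t - a) := div_pos hsa hta
  have hk2 : 0 < (b - s) / (b - t) := div_pos hbs hbt
  have e1 : a + (s - a) / (t - a) * (t - a) = s := by rw [div_mul_cancel₀ _ hta.ne']; ring
  have e2 : b + (b - s) / (b - t) * (t - b) = s := by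
    have := div_mul_cancel₀ (b - s) hbt.ne'
    linarith
  -- The lines through `(a, a)` and `(b, b)` meet at `(t, s)`. If `t ≤ s`, their minimum lies above
  -- the diagonal exactly on the middle stretch, so the maximum with the identity is the desired
  -- map; the other case is dual.
  rcases le_total t s with hts | hst
  · have g1 : 1 ≤ (s - a) / (t - a) := (one_le_div hta).2 (by linarith)
    have g2 : (b - s) / (b - t) ≤ 1 := (div_le_one hbt).2 (by linarith)
    refine ⟨_, id.max ((affine hk1 a a).min (affine hk2 b b)), ?_, fun y hy => ?_, fun y hy => ?_⟩
    · simp only [e1, e2, min_self]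
      exact max_eq_right hts
    · refine max_eq_left (min_le_of_left_le ?_)
      nlinarith
    · refine max_eq_left (min_le_of_right_le ?_)
      nlinarith
  · have g1 : (s - a) / (t - a) ≤ 1 := (div_le_one hta).2 (by linarith)
    have g2 : 1 ≤ (b - s) / (b - t) := (one_le_div hbt).2 (by linarith)
    refine ⟨_, id.min ((affine hk1 a a).max (affine hk2 b b)), ?_, fun y hy => ?_, fun y hy => ?_⟩
    · simp only [e1, e2, max_self]
      exact min_eq_right hst
    · refine min_eq_left (le_max_of_le_left ?_)
      nlinarith
    · refine min_eq_left (le_max_of_le_right ?_)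
      nlinarith

/-- Strict inequalities leave room for real endpoints inside `(a, b)`, so infinite bounds cause no
trouble. -/
theorem exists_map_eq_of_ereal {a b : EReal} {s t : ℝ} (hat : a < t) (htb : t < b) (has : a < s)
    (hsb : s < b) : ∃ f, HasBoundedSlopes f ∧ f t = s ∧
      ∀ y : ℝ, (y : EReal) ≤ a ∨ b ≤ y → f y = y := by
  obtain ⟨a', ha, ha'⟩ := EReal.lt_iff_exists_real_btwn.1 (lt_min hat has)
  obtain ⟨b', hb', hb⟩ := EReal.lt_iff_exists_real_btwn.1 (max_lt htb hsb)
  rw [lt_min_iff, EReal.coe_lt_coe_iff, EReal.coe_lt_coe_iff] at ha'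
  rw [max_lt_iff, EReal.coe_lt_coe_iff, EReal.coe_lt_coe_iff] at hb'
  obtain ⟨f, hf, hft, h1, h2⟩ := exists_map_eq ha'.1 hb'.1 ha'.2 hb'.2
  refine ⟨f, hf, hft, fun y hy => ?_⟩
  rcases hy with hy | hy
  · exact h1 y (EReal.coe_le_coe_iff.1 (hy.trans ha.le))
  · exact h2 y (EReal.coe_le_coe_iff.1 (hb.le.trans hy))

end HasBoundedSlopes

/-! ### Rescaling the utilities of a model. -/

namespace MDM

variable {n : ℕ}

/-- A condition on masses of intervals transports along a strictly increasing pushforward. -/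
theorem strictMonoOn_cdf_iff (μ : Measure ℝ) [IsProbabilityMeasure μ] :
    StrictMonoOn (ProbabilityTheory.cdf μ) μ.support ↔
      ∀ x ∈ μ.support, ∀ y ∈ μ.support, x < y → μ (Set.Ioc x y) ≠ 0 := by
  refine forall₂_congr fun x hx => ?_
  refine ⟨fun h y hy hxy => ?_, fun h y hy hxy => ?_⟩
  · have := h hy hxy
    rw [← ProbabilityTheory.measure_cdf μ, StieltjesFunction.measure_Ioc]
    simpa using this
  · have := h y hy hxy
    rw [← ProbabilityTheory.measure_cdf μ, StieltjesFunction.measure_Ioc] at this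
    simpa using this

/-- The model in which the utility of product `i` is transformed by the increasing map `ψ i`. -/
noncomputable def transform (M : MDM n) (ψ : Fin n → ℝ → ℝ) (hψ : ∀ i, HasBoundedSlopes (ψ i)) :
    MDM n where
  -- The deterministic utility is absorbed into the transformed shock.
  ν := 0
  μ i := (M.μ i).map fun t => ψ i (M.ν i + t)
  isProbabilityMeasure i := Measure.isProbabilityMeasure_map
    ((hψ i).continuous.comp (continuous_const.add continuous_id)).measurable.aemeasurable
  absolutelyContinuous i := by
    have hm : Measurable fun t => ψ i (M.ν i + t) :=
      ((hψ i).continuous.comp (continuous_const.add continuous_id)).measurable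
    refine Measure.AbsolutelyContinuous.mk fun s hs h0 => ?_
    rw [Measure.map_apply hm hs]
    refine M.absolutelyContinuous i ?_
    have h1 := (hψ i).volume_preimage_eq_zero h0
    rw [← measure_preimage_add volume (M.ν i)] at h1
    exact h1
  strictMonoOn_cdf i := by
    have hc : Continuous fun t => ψ i (M.ν i + t) :=
      (hψ i).continuous.comp (continuous_const.add continuous_id)
    have hsurj : Function.Surjective fun t => ψ i (M.ν i + t) :=
      (hψ i).surjective.comp (add_left_surjective _)
    have := Measure.isProbabilityMeasure_map (μ := M.μ i) hc.measurable.aemeasurable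
    rw [strictMonoOn_cdf_iff]
    have hM := (strictMonoOn_cdf_iff (M.μ i)).1 (M.strictMonoOn_cdf i)
    have hmono : StrictMono fun t => ψ i (M.ν i + t) := fun s t h =>
      (hψ i).strictMono (by linarith)
    have hsupp : ∀ t, ψ i (M.ν i + t) ∈ ((M.μ i).map fun t => ψ i (M.ν i + t)).support →
        t ∈ (M.μ i).support := by
      intro t ht
      rw [Measure.mem_support_iff_forall] at ht ⊢
      intro U hU
      obtain ⟨l, u, htlu, hsub⟩ := mem_nhds_iff_exists_Ioo_subset.1 hU
      have h1 := ht _ (Ioo_mem_nhds (hmono htlu.1) (hmono htlu.2))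
      rw [Measure.map_apply hc.measurable measurableSet_Ioo] at h1
      refine h1.trans_le (measure_mono fun z hz => hsub ?_)
      exact ⟨hmono.lt_iff_lt.1 hz.1, hmono.lt_iff_lt.1 hz.2⟩
    intro x hx y hy hxy
    obtain ⟨u, rfl⟩ := hsurj x
    obtain ⟨v, rfl⟩ := hsurj y
    rw [Measure.map_apply hc.measurable measurableSet_Ioc]
    have : (fun t => ψ i (M.ν i + t)) ⁻¹' Set.Ioc (ψ i (M.ν i + u)) (ψ i (M.ν i + v))
        = Set.Ioc u v := by
      ext z
      exact and_congr hmono.lt_iff_lt hmono.le_iff_le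
    simp only at this ⊢
    rw [this]
    exact hM u (hsupp u hx) v (hsupp v hy) (hmono.lt_iff_lt.1 hxy)
  integrable i := by
    have := M.isProbabilityMeasure i
    have hc : Continuous fun t => ψ i (M.ν i + t) :=
      (hψ i).continuous.comp (continuous_const.add continuous_id)
    rw [integrable_map_measure (by fun_prop) hc.measurable.aemeasurable]
    obtain ⟨c, K, hc0, hK, h⟩ := (hψ i).exists_abs_sub_le
    refine Integrable.mono' (g := fun t => |ψ i 0| + K * |M.ν i + t|) ?_
      hc.aestronglyMeasurable (Filter.Eventually.of_forall fun t => ?_)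
    · exact (integrable_const _).add
        (((integrable_const _).add (M.integrable i)).abs.const_mul K)
    · have h1 := (h 0 (M.ν i + t)).2
      rw [sub_zero] at h1
      have h2 := abs_sub_abs_le_abs_sub (ψ i (M.ν i + t)) (ψ i 0)
      simp only [Function.comp_apply, Real.norm_eq_abs]
      linarith

theorem exceedProb_transform (M : MDM n) (ψ : Fin n → ℝ → ℝ) (hψ : ∀ i, HasBoundedSlopes (ψ i))
    (i : Fin n) (y : ℝ) :
    (M.transform ψ hψ).exceedProb i (ψ i y : ℝ) = M.exceedProb i y := by
  have hc : Continuous fun t => ψ i (M.ν i + t) :=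
    (hψ i).continuous.comp (continuous_const.add continuous_id)
  rw [exceedProb, exceedProb, measureReal_def, measureReal_def]
  congr 1
  change ((M.μ i).map fun t => ψ i (M.ν i + t)) _ = _
  rw [Measure.map_apply hc.measurable (measurableSet_exceedSet _ _ _)]
  congr 1
  ext t
  simp only [exceedSet, Set.mem_preimage, Set.mem_ofPred_eq, EReal.coe_lt_coe_iff]
  change ψ i y < 0 + ψ i (M.ν i + t) ↔ _
  rw [zero_add, (hψ i).strictMono.lt_iff_lt]

end MDM

/-! ### Representability in terms of levels, and monotonicity of the data. -/

theorem nonempty_of_mem_simplexOn {n : ℕ} {A : Finset (Fin n)} {x : Fin n → ℝ}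
    (hx : x ∈ simplexOn A) : A.Nonempty := by
  rw [Finset.nonempty_iff_ne_empty]
  rintro rfl
  simpa using hx.2

theorem le_one_of_mem_simplexOn {n : ℕ} {A : Finset (Fin n)} {x : Fin n → ℝ}
    (hx : x ∈ simplexOn A) {i : Fin n} (hi : i ∈ A) : x i ≤ 1 :=
  hx.2 ▸ Finset.single_le_sum (f := x) hx.1 hi

/-- Both vectors have total mass one, so domination on the smaller set leaves no slack. -/
theorem eq_of_le_of_mem_simplexOn {n : ℕ} {T U : Finset (Fin n)} (hTU : T ⊆ U) {q q' : Fin n → ℝ}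
    (hq : q ∈ simplexOn T) (hq' : q' ∈ simplexOn U) (h : ∀ i ∈ T, q i ≤ q' i) :
    ∀ i ∈ T, q i = q' i := by
  have h1 : ∑ i ∈ T, q' i ≤ 1 :=
    hq'.2 ▸ Finset.sum_le_sum_of_subset_of_nonneg hTU fun i hi _ => hq'.1 i hi
  exact (Finset.sum_eq_sum_iff_of_le h).1 (le_antisymm (Finset.sum_le_sum h) (h1.trans hq.2.ge))

theorem eq_zero_of_le_of_mem_simplexOn {n : ℕ} {T U : Finset (Fin n)} (hTU : T ⊆ U)
    {q q' : Fin n → ℝ} (hq : q ∈ simplexOn T) (hq' : q' ∈ simplexOn U)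
    (h : ∀ i ∈ T, q i ≤ q' i) {i : Fin n} (hi : i ∈ U) (hiT : i ∉ T) : q' i = 0 := by
  have h1 : ∑ i ∈ T, q' i = ∑ i ∈ U, q' i := by
    rw [hq'.2, ← hq.2]
    exact Finset.sum_congr rfl fun i hi => (eq_of_le_of_mem_simplexOn hTU hq hq' h i hi).symm
  rw [← Finset.sum_sdiff hTU, right_eq_add,
    Finset.sum_eq_zero_iff_of_nonneg fun i hi => hq'.1 i (Finset.mem_sdiff.1 hi).1] at h1
  exact h1 i (Finset.mem_sdiff.2 ⟨hi, hiT⟩)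

/-- The condition that the exceedance probabilities sum to one is already contained in the simplex
constraint. -/
theorem mem_mdmProbabilities_iff {n : ℕ} {𝒮 : Finset (Finset (Fin n))}
    {p : Finset (Fin n) → Fin n → ℝ} :
    p ∈ mdmProbabilities 𝒮 ↔ (∀ T ∈ 𝒮, p T ∈ simplexOn T) ∧
      ∃ M : MDM n, ∀ T ∈ 𝒮, ∃ l, ∀ i ∈ T, p T i = M.exceedProb i l := by
  refine and_congr_right fun h => exists_congr fun M => forall₂_congr fun T hT => ?_
  rw [MDM.generates_iff (nonempty_of_mem_simplexOn (h T hT))]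
  refine exists_congr fun l => and_iff_right_of_imp fun hl => ?_
  rw [← (h T hT).2]
  exact Finset.sum_congr rfl fun i hi => (hl i hi).symm

theorem mem_consistentSet_iff {n : ℕ} {𝒮 : Finset (Finset (Fin n))}
    {p : Finset (Fin n) → Fin n → ℝ} {A : Finset (Fin n)} (hA : A ∉ 𝒮) {x : Fin n → ℝ} :
    x ∈ consistentSet 𝒮 p A ↔ (x ∈ simplexOn A ∧ ∀ T ∈ 𝒮, p T ∈ simplexOn T) ∧
      ∃ M : MDM n, (∃ l, ∀ i ∈ A, x i = M.exceedProb i l) ∧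
        ∀ T ∈ 𝒮, ∃ l, ∀ i ∈ T, p T i = M.exceedProb i l := by
  have hne : ∀ T ∈ 𝒮, Function.update p A x T = p T := fun T hT =>
    Function.update_of_ne (ne_of_mem_of_not_mem hT hA) _ _
  rw [consistentSet, Set.mem_ofPred_eq, mem_mdmProbabilities_iff]
  simp only [Finset.forall_mem_insert, Function.update_self]
  refine and_congr (and_congr_right fun _ => forall₂_congr fun T hT => by rw [hne T hT]) ?_
  exact exists_congr fun M => and_congr_right fun _ => forall₂_congr fun T hT => by rw [hne T hT]

/-- Choice probabilities decrease when the assortment grows. -/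
theorem MDM.exceedProb_le_of_subset {n : ℕ} (M : MDM n) {T U : Finset (Fin n)} (hTU : T ⊆ U)
    {q q' : Fin n → ℝ} (hq : q ∈ simplexOn T) (hq' : q' ∈ simplexOn U) {l l' : EReal}
    (h : ∀ i ∈ T, q i = M.exceedProb i l) (h' : ∀ i ∈ U, q' i = M.exceedProb i l') {i : Fin n}
    (hi : i ∈ T) : q' i ≤ q i := by
  rcases le_total l l' with hl | hl
  · rw [h i hi, h' i (hTU hi)]
    exact M.antitone_exceedProb i hl
  · refine (eq_of_le_of_mem_simplexOn hTU hq hq' (fun j hj => ?_) i hi).ge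
    rw [h j hj, h' j (hTU hj)]
    exact M.antitone_exceedProb j hl

theorem antitone_of_mem_mdmProbabilities {n : ℕ} {𝒮 : Finset (Finset (Fin n))}
    {p : Finset (Fin n) → Fin n → ℝ} (hp : p ∈ mdmProbabilities 𝒮) {T U : Finset (Fin n)}
    (hT : T ∈ 𝒮) (hU : U ∈ 𝒮) (hTU : T ⊆ U) {i : Fin n} (hi : i ∈ T) : p U i ≤ p T i := by
  obtain ⟨hs, M, hM⟩ := mem_mdmProbabilities_iff.1 hp
  obtain ⟨l, hl⟩ := hM T hT
  obtain ⟨l', hl'⟩ := hM U hU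
  exact M.exceedProb_le_of_subset hTU (hs T hT) (hs U hU) hl hl' hi

/-! ### The sandwich regions and their relation to the programs. -/

/-- The vectors over `A` lying below the data of the first `k` assortments and above the data of
the remaining ones. -/
def sandwichRegion {n m : ℕ} (S : Fin m → Finset (Fin n)) (p : Finset (Fin n) → Fin n → ℝ)
    (A : Finset (Fin n)) (k : ℕ) : Set (Fin n → ℝ) :=
  {x | (∀ j : Fin m, (j : ℕ) < k → ∀ i ∈ A ∩ S j, x i ≤ p (S j) i) ∧
    (∀ j : Fin m, k ≤ (j : ℕ) → ∀ i ∈ A ∩ S j, p (S j) i ≤ x i) ∧ x ∈ simplexOn A}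

/-- The data decrease along the chain, so among the first `k` assortments the last one containing
everything before it gives the tightest upper bounds. -/
theorem nestedFeasible_eq_sandwichRegion {n m : ℕ} {𝒮 : Finset (Finset (Fin n))}
    {S : Fin m → Finset (Fin n)} (hS : IsNestedEnumeration 𝒮 S)
    {p : Finset (Fin n) → Fin n → ℝ} (hp : p ∈ mdmProbabilities 𝒮) (A : Finset (Fin n))
    (k : Fin (m + 1)) : nestedFeasible 𝒮 S p A k = sandwichRegion S p A k := by
  have hmem : ∀ j, S j ∈ 𝒮 := fun j => (hS.2 _).2 ⟨j, rfl⟩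
  ext x
  constructor
  · rintro ⟨h1, h2, h3⟩
    refine ⟨fun j hj i hi => ?_, fun j hj i hi => ?_, h3⟩
    · have hlt : (k : ℕ) - 1 < m := by omega
      have hle : S j ⊆ S ⟨k - 1, hlt⟩ := hS.1.monotone (Fin.le_def.2 (by simp only; omega))
      rw [Finset.mem_inter] at hi
      exact (h1 ⟨k - 1, hlt⟩ (by simp only; omega) i (Finset.mem_inter.2 ⟨hi.1, hle hi.2⟩)).trans
        (antitone_of_mem_mdmProbabilities hp (hmem _) (hmem _) hle hi.2)
    · exact h2 ⟨k, by omega⟩ rfl (S j) (hmem j) (hS.1.monotone (Fin.le_def.2 hj)) i hi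
  · rintro ⟨h1, h2, h3⟩
    refine ⟨fun j hj i hi => h1 j (by omega) i hi, fun j hj T hT hjT i hi => ?_, h3⟩
    obtain ⟨q, rfl⟩ := (hS.2 T).1 hT
    have : j ≤ q := hS.1.le_iff_le.1 hjT
    exact h2 q (by rw [← hj]; exact this) i hi

/-- Every consistent vector is feasible for one of the programs. -/
theorem exists_mem_sandwichRegion {n m : ℕ} {𝒮 : Finset (Finset (Fin n))}
    {S : Fin m → Finset (Fin n)} (hS : IsNestedEnumeration 𝒮 S)
    {p : Finset (Fin n) → Fin n → ℝ} (hp : p ∈ mdmProbabilities 𝒮) {A : Finset (Fin n)}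
    (hA : A ∉ 𝒮) {x : Fin n → ℝ} (hx : x ∈ consistentSet 𝒮 p A) :
    ∃ k : Fin (m + 1), x ∈ sandwichRegion S p A k := by
  have hmem : ∀ j, S j ∈ 𝒮 := fun j => (hS.2 _).2 ⟨j, rfl⟩
  obtain ⟨⟨hxs, -⟩, M, ⟨l, hl⟩, hM⟩ := (mem_consistentSet_iff hA).1 hx
  choose L hL using fun j => hM (S j) (hmem j)
  let F := Finset.univ.filter fun j => L j ≤ l
  have hk : F.sup (fun j : Fin m => (j : ℕ) + 1) ≤ m := Finset.sup_le fun j _ => j.2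
  -- `k` is one more than the largest index whose level is at most `l`, and `0` if there is none.
  -- The levels themselves need not be ordered along the chain: for `j < k` the bound comes from
  -- some `q ≥ j` in `F` and the monotonicity of the data.
  refine ⟨⟨F.sup fun j : Fin m => (j : ℕ) + 1, by omega⟩, fun j hj i hi => ?_, fun j hj i hi => ?_,
    hxs⟩
  · obtain ⟨q, hq, hjq⟩ :=
      Finset.lt_sup_iff.1 (show (j : ℕ) < F.sup fun j : Fin m => (j : ℕ) + 1 from hj)
    have hle : S j ⊆ S q := hS.1.monotone (Fin.le_def.2 (by omega))
    rw [Finset.mem_inter] at hi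
    refine le_trans ?_ (antitone_of_mem_mdmProbabilities hp (hmem _) (hmem _) hle hi.2)
    rw [hl i hi.1, hL q i (hle hi.2)]
    exact M.antitone_exceedProb i (Finset.mem_filter.1 hq).2
  · rw [Finset.mem_inter] at hi
    rw [hl i hi.1, hL j i hi.2]
    refine M.antitone_exceedProb i (le_of_not_ge fun hle => ?_)
    have := Finset.le_sup (f := fun j : Fin m => (j : ℕ) + 1)
      (Finset.mem_filter.2 ⟨Finset.mem_univ j, hle⟩ : j ∈ F)
    exact absurd (this.trans hj) (Nat.not_succ_le_self _)

/-- A vector of some region lies in a region whose two groups of assortments have levels that are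
strictly separated. -/
theorem exists_separated_sandwichRegion {n m : ℕ} {S : Fin m → Finset (Fin n)} (hS : StrictMono S)
    {p : Finset (Fin n) → Fin n → ℝ} (hs : ∀ j, p (S j) ∈ simplexOn (S j)) {M : MDM n}
    {L : Fin m → EReal} (hL : ∀ j, ∀ i ∈ S j, p (S j) i = M.exceedProb i (L j))
    {A : Finset (Fin n)} {x : Fin n → ℝ} (k : ℕ) (hx : x ∈ sandwichRegion S p A k) :
    ∃ k, x ∈ sandwichRegion S p A k ∧
      ∀ j q : Fin m, (j : ℕ) < k → k ≤ (q : ℕ) → L j < L q := by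
  induction k using Nat.strong_induction_on with
  | _ k ih =>
    by_cases h : ∀ j q : Fin m, (j : ℕ) < k → k ≤ (q : ℕ) → L j < L q
    · exact ⟨k, hx, h⟩
    push Not at h
    obtain ⟨j, q, hjk, hkq, hqj⟩ := h
    obtain ⟨h1, h2, h3⟩ := hx
    -- The inversion `L q ≤ L j` forces the data of `S j` and `S q` to agree on `S j`. For `j ≤ a <
    -- k` the data of `S a` are squeezed between them on `S j` and vanish on the rest of `S a`, so
    -- they also lie below `x`, and `k` may be lowered to `j`.
    refine ih j hjk ⟨fun a ha => h1 a (ha.trans hjk), fun a ha i hi => ?_, h3⟩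
    rcases le_or_gt k a with hka | hak
    · exact h2 a hka i hi
    have hja : S j ⊆ S a := hS.monotone (Fin.le_def.2 ha)
    have haq : S a ⊆ S q := hS.monotone (Fin.le_def.2 (by omega))
    have hdec : ∀ i ∈ S a, p (S q) i ≤ p (S a) i := fun i hi =>
      M.exceedProb_le_of_subset haq (hs a) (hs q) (hL a) (hL q) hi
    have hjq : ∀ i ∈ S j, p (S j) i ≤ p (S q) i := fun i hi => by
      rw [hL j i hi, hL q i (haq (hja hi))]
      exact M.antitone_exceedProb i hqj
    rw [Finset.mem_inter] at hi
    by_cases hij : i ∈ S j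
    · refine le_trans ?_ (h2 q hkq i (Finset.mem_inter.2 ⟨hi.1, haq hi.2⟩))
      exact (M.exceedProb_le_of_subset hja (hs j) (hs a) (hL j) (hL a) hij).trans (hjq i hij)
    · rw [eq_zero_of_le_of_mem_simplexOn hja (hs j) (hs a)
        (fun i hi => (hjq i hi).trans (hdec i (hja hi))) hi.2 hij]
      exact h3.1 i hi.1

/-! ### Approximating feasible vectors by consistent ones. -/

/-- The intermediate value theorem may return an endpoint, which cannot be moved when the data
levels are fixed; density of the open interval trades exactness for a real interior point. -/
theorem exists_real_abs_sub_lt {f : EReal → ℝ} (hf : Continuous f) {a b : EReal} (hab : a < b)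
    {x δ : ℝ} (hb : f b ≤ x) (ha : x ≤ f a) (hδ : 0 < δ) :
    ∃ t : ℝ, a < t ∧ (t : EReal) < b ∧ |f t - x| < δ := by
  obtain ⟨t, ht, hft⟩ := intermediate_value_Icc' hab.le hf.continuousOn ⟨hb, ha⟩
  rw [← closure_Ioo hab.ne] at ht
  obtain ⟨u, hu, hu'⟩ := mem_closure_iff.1 ht {u | |f u - x| < δ}
    (isOpen_lt (by fun_prop) continuous_const) (by simpa [hft] using hδ)
  lift u to ℝ using ⟨hu'.2.ne_top, hu'.1.ne_bot⟩
  exact ⟨u, hu'.1, hu'.2, hu⟩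

theorem MDM.ne_top_of_mem_simplexOn {n : ℕ} {M : MDM n} {T : Finset (Fin n)} {q : Fin n → ℝ}
    (hq : q ∈ simplexOn T) {l : EReal} (h : ∀ i ∈ T, q i = M.exceedProb i l) : l ≠ ⊤ := by
  rintro rfl
  have := hq.2
  rw [Finset.sum_eq_zero fun i hi => by rw [h i hi, M.exceedProb_top]] at this
  exact zero_ne_one this

/-- A model can be transformed, keeping the data, so that its exceedance probabilities at some
level are close to a vector of a separated region. -/
theorem exists_model_near {n m : ℕ} {S : Fin m → Finset (Fin n)}
    {p : Finset (Fin n) → Fin n → ℝ} (hs : ∀ j, p (S j) ∈ simplexOn (S j)) {M : MDM n}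
    {L : Fin m → EReal} (hL : ∀ j, ∀ i ∈ S j, p (S j) i = M.exceedProb i (L j))
    {A : Finset (Fin n)} {x : Fin n → ℝ} {k : ℕ} (hx : x ∈ sandwichRegion S p A k)
    (hsep : ∀ j q : Fin m, (j : ℕ) < k → k ≤ (q : ℕ) → L j < L q) {δ : ℝ} (hδ : 0 < δ) :
    ∃ M' : MDM n, (∀ j, ∀ i ∈ S j, p (S j) i = M'.exceedProb i (L j)) ∧
      ∃ s : EReal, ∀ i ∈ A, |M'.exceedProb i s - x i| < δ := by
  obtain ⟨h1, h2, h3⟩ := hx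
  set Fa : Fin n → Finset (Fin m) := fun i => Finset.univ.filter fun j => (j : ℕ) < k ∧ i ∈ S j
  -- Levels equal to `⊥` are left out: they would leave no room for `s` below them, and the data
  -- there equal one in every model.
  set Fb : Fin n → Finset (Fin m) := fun i =>
    Finset.univ.filter fun j => (k ≤ (j : ℕ) ∧ L j ≠ ⊥) ∧ i ∈ S j
  have ha : ∀ i, (Fa i).sup L ≤ (Finset.univ.filter fun j : Fin m => (j : ℕ) < k).sup L := fun i =>
    Finset.sup_mono (Finset.monotone_filter_right _ fun _ _ h => h.1)
  have hb : ∀ i, (Finset.univ.filter fun j : Fin m => k ≤ (j : ℕ) ∧ L j ≠ ⊥).inf L ≤ (Fb i).inf L :=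
    fun i => Finset.inf_mono (Finset.monotone_filter_right _ fun _ _ h => h.1)
  have hab : (Finset.univ.filter fun j : Fin m => (j : ℕ) < k).sup L <
      (Finset.univ.filter fun j : Fin m => k ≤ (j : ℕ) ∧ L j ≠ ⊥).inf L := by
    rw [Finset.sup_lt_iff]
    · intro j hj
      rw [Finset.lt_inf_iff (MDM.ne_top_of_mem_simplexOn (hs j) (hL j)).lt_top]
      exact fun q hq => hsep j q (Finset.mem_filter.1 hj).2 (Finset.mem_filter.1 hq).2.1
    · rw [Finset.lt_inf_iff bot_lt_top]
      exact fun q hq => bot_lt_iff_ne_bot.2 (Finset.mem_filter.1 hq).2.2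
  obtain ⟨s, has, hsb⟩ := EReal.lt_iff_exists_real_btwn.1 hab
  have key : ∀ i, ∃ f t, HasBoundedSlopes f ∧ f t = s ∧
      (∀ y : ℝ, (y : EReal) ≤ (Fa i).sup L ∨ (Fb i).inf L ≤ y → f y = y) ∧
      (i ∈ A → |M.exceedProb i (t : ℝ) - x i| < δ) := by
    intro i
    have hasi := (ha i).trans_lt has
    have hsbi := hsb.trans_le (hb i)
    by_cases hi : i ∈ A
    · obtain ⟨t, hat, htb, ht⟩ := exists_real_abs_sub_lt (M.continuous_exceedProb i) (x := x i)
        (hasi.trans hsbi) (by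
          -- An empty family puts the bound at `⊤`, where the exceedance probability is `0 ≤ x i`;
          -- below, an empty `Fa i` puts it at `⊥`, where it is `1 ≥ x i`.
          rcases (Fb i).eq_empty_or_nonempty with he | hne
          · rw [he, Finset.inf_empty, M.exceedProb_top]
            exact h3.1 i hi
          · obtain ⟨j, hj, he⟩ := Finset.exists_mem_eq_inf _ hne L
            obtain ⟨⟨hjk, -⟩, hij⟩ := (Finset.mem_filter.1 hj).2
            rw [he, ← hL j i hij]
            exact h2 j hjk i (Finset.mem_inter.2 ⟨hi, hij⟩)) (by
          rcases (Fa i).eq_empty_or_nonempty with he | hne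
          · rw [he, Finset.sup_empty, M.exceedProb_bot]
            exact le_one_of_mem_simplexOn h3 hi
          · obtain ⟨j, hj, he⟩ := Finset.exists_mem_eq_sup _ hne L
            obtain ⟨hjk, hij⟩ := (Finset.mem_filter.1 hj).2
            rw [he, ← hL j i hij]
            exact h1 j hjk i (Finset.mem_inter.2 ⟨hi, hij⟩)) hδ
      obtain ⟨f, hf, hft, hfix⟩ := HasBoundedSlopes.exists_map_eq_of_ereal hat htb hasi hsbi
      exact ⟨f, t, hf, hft, hfix, fun _ => ht⟩
    · exact ⟨fun y => y, s, HasBoundedSlopes.id, rfl, fun _ _ => rfl, fun h => absurd h hi⟩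
  choose ψ t hψ hψt hfix hclose using key
  refine ⟨M.transform ψ hψ, fun j i hij => ?_, s, fun i hi => ?_⟩
  · rw [hL j i hij]
    rcases eq_or_ne (L j) ⊥ with hbot | hbot
    · simp [hbot]
    have htop := MDM.ne_top_of_mem_simplexOn (hs j) (hL j)
    have hy : ψ i (L j).toReal = (L j).toReal := by
      refine hfix i _ ?_
      rw [EReal.coe_toReal htop hbot]
      rcases lt_or_ge (j : ℕ) k with hjk | hjk
      · exact Or.inl (Finset.le_sup (Finset.mem_filter.2 ⟨Finset.mem_univ j, hjk, hij⟩))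
      · exact Or.inr (Finset.inf_le (Finset.mem_filter.2 ⟨Finset.mem_univ j, ⟨hjk, hbot⟩, hij⟩))
    have := M.exceedProb_transform ψ hψ i (L j).toReal
    rw [hy, EReal.coe_toReal htop hbot] at this
    exact this.symm
  · rw [← hψt i, M.exceedProb_transform]
    exact hclose i hi

/-- If the exceedance probabilities at some level are close to a probability vector, so are the
choice probabilities. -/
theorem MDM.abs_exceedProb_sub_le {n : ℕ} (M : MDM n) {A : Finset (Fin n)} {x : Fin n → ℝ}
    (hx : x ∈ simplexOn A) {s l : EReal} {δ : ℝ} (hs : ∀ i ∈ A, |M.exceedProb i s - x i| < δ)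
    (hl : ∑ i ∈ A, M.exceedProb i l = 1) {i : Fin n} (hi : i ∈ A) :
    |M.exceedProb i l - x i| ≤ (A.card + 1) * δ := by
  have h1 : |∑ i ∈ A, (M.exceedProb i s - M.exceedProb i l)| ≤ A.card * δ := by
    rw [Finset.sum_sub_distrib, hl, ← hx.2, ← Finset.sum_sub_distrib, ← nsmul_eq_mul]
    exact (Finset.abs_sum_le_sum_abs _ _).trans (Finset.sum_le_card_nsmul _ _ _ fun i hi =>
      (hs i hi).le)
  -- Passing from `s` to `l` moves all exceedance probabilities in the same direction, so each
  -- change is at most the absolute value of the total change.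
  have h2 : |M.exceedProb i s - M.exceedProb i l| ≤ A.card * δ := by
    refine le_trans ?_ h1
    rcases le_total s l with h | h
    · have hn : ∀ j ∈ A, 0 ≤ M.exceedProb j s - M.exceedProb j l := fun j _ =>
        sub_nonneg.2 (M.antitone_exceedProb j h)
      rw [abs_of_nonneg (hn i hi), abs_of_nonneg (Finset.sum_nonneg hn)]
      exact Finset.single_le_sum hn hi
    · have hn : ∀ j ∈ A, 0 ≤ M.exceedProb j l - M.exceedProb j s := fun j _ =>
        sub_nonneg.2 (M.antitone_exceedProb j h)
      rw [abs_sub_comm, ← abs_neg (∑ i ∈ A, _), ← Finset.sum_neg_distrib]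
      simp only [neg_sub]
      rw [abs_of_nonneg (hn i hi), abs_of_nonneg (Finset.sum_nonneg hn)]
      exact Finset.single_le_sum hn hi
  have h3 := abs_sub_le (M.exceedProb i l) (M.exceedProb i s) (x i)
  rw [abs_sub_comm (M.exceedProb i l) (M.exceedProb i s)] at h3
  have := hs i hi
  linarith

/-- Every feasible vector is a limit of consistent ones. -/
theorem exists_mem_consistentSet_near {n m : ℕ} {𝒮 : Finset (Finset (Fin n))}
    {S : Fin m → Finset (Fin n)} (hS : IsNestedEnumeration 𝒮 S)
    {p : Finset (Fin n) → Fin n → ℝ} (hp : p ∈ mdmProbabilities 𝒮) {A : Finset (Fin n)}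
    (hA : A ∉ 𝒮) {x : Fin n → ℝ} {k : ℕ} (hx : x ∈ sandwichRegion S p A k) {δ : ℝ} (hδ : 0 < δ) :
    ∃ y ∈ consistentSet 𝒮 p A, ∀ i ∈ A, |y i - x i| ≤ δ := by
  have hmem : ∀ j, S j ∈ 𝒮 := fun j => (hS.2 _).2 ⟨j, rfl⟩
  obtain ⟨hs, M, hM⟩ := mem_mdmProbabilities_iff.1 hp
  choose L hL using fun j => hM (S j) (hmem j)
  obtain ⟨k, hx, hsep⟩ := exists_separated_sandwichRegion hS.1 (fun j => hs _ (hmem j)) hL k hx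
  have hc : (0 : ℝ) < A.card + 1 := by positivity
  obtain ⟨M', hM', s, hs'⟩ := exists_model_near (fun j => hs _ (hmem j)) hL hx hsep (div_pos hδ hc)
  obtain ⟨l, hl⟩ := M'.exists_sum_exceedProb_eq_one (nonempty_of_mem_simplexOn hx.2.2)
  refine ⟨fun i => M'.exceedProb i l, (mem_consistentSet_iff hA).2
    ⟨⟨⟨fun i _ => M'.exceedProb_nonneg i l, hl⟩, hs⟩, M', ⟨l, fun _ _ => rfl⟩, fun T hT => ?_⟩,
    fun i hi => ?_⟩
  · obtain ⟨j, rfl⟩ := (hS.2 T).1 hT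
    exact ⟨L j, hM' j⟩
  · have := M'.abs_exceedProb_sub_le hx.2.2 hs' hl hi
    rwa [mul_div_cancel₀ _ hc.ne'] at this

/-! ### Revenue: passing to the limit, attainment and the conclusion. -/

theorem abs_revenue_sub_le {n : ℕ} (r : Fin n → ℝ) {A : Finset (Fin n)} {x y : Fin n → ℝ} {δ : ℝ}
    (h : ∀ i ∈ A, |y i - x i| ≤ δ) : |revenue r A y - revenue r A x| ≤ (∑ i ∈ A, |r i|) * δ := by
  rw [revenue, revenue, ← Finset.sum_sub_distrib, Finset.sum_mul]
  refine (Finset.abs_sum_le_sum_abs _ _).trans (Finset.sum_le_sum fun i hi => ?_)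
  rw [← mul_sub, abs_mul]
  exact mul_le_mul_of_nonneg_left (h i hi) (abs_nonneg _)

theorem infRevenue_le_of_near {n : ℕ} (r : Fin n → ℝ) {A : Finset (Fin n)}
    {C : Set (Fin n → ℝ)} {x : Fin n → ℝ}
    (h : ∀ δ : ℝ, 0 < δ → ∃ y ∈ C, ∀ i ∈ A, |y i - x i| ≤ δ) :
    infRevenue r A C ≤ (revenue r A x : ℝ) := by
  rw [← EReal.le_of_forall_lt_iff_le]
  intro z hz
  rw [EReal.coe_lt_coe_iff] at hz
  have hR : 0 ≤ ∑ i ∈ A, |r i| := Finset.sum_nonneg fun i _ => abs_nonneg _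
  -- The sum is a Lipschitz constant of the revenue; adding one keeps the divisor positive.
  have hc : 0 < ∑ i ∈ A, |r i| + 1 := by linarith
  obtain ⟨y, hy, hyx⟩ := h ((z - revenue r A x) / (∑ i ∈ A, |r i| + 1))
    (div_pos (sub_pos.2 hz) hc)
  refine (iInf₂_le y hy).trans (EReal.coe_le_coe_iff.2 ?_)
  have h1 := (abs_le.1 (abs_revenue_sub_le r hyx)).2
  have h2 : (∑ i ∈ A, |r i|) * ((z - revenue r A x) / (∑ i ∈ A, |r i| + 1))
      ≤ z - revenue r A x := by
    rw [mul_div_assoc', div_le_iff₀ hc]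
    nlinarith
  linarith

theorem exists_revenue_eq_infRevenue {n m : ℕ} (S : Fin m → Finset (Fin n))
    (p : Finset (Fin n) → Fin n → ℝ) (r : Fin n → ℝ) (A : Finset (Fin n)) (k : ℕ)
    (hne : (sandwichRegion S p A k).Nonempty) :
    ∃ x ∈ sandwichRegion S p A k,
      infRevenue r A (sandwichRegion S p A k) = ((revenue r A x : ℝ) : EReal) := by
  -- Coordinates outside `A` are unconstrained; setting them to zero preserves the revenue and makes
  -- the region compact.
  set C := sandwichRegion S p A k ∩ {x | ∀ i ∉ A, x i = 0} with hC
  have htrunc : ∀ x ∈ sandwichRegion S p A k, ∃ y ∈ C, revenue r A y = revenue r A x := by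
    rintro x ⟨h1, h2, h3, h4⟩
    have hon : ∀ i ∈ A, (fun i => if i ∈ A then x i else 0) i = x i := fun i hi => if_pos hi
    refine ⟨fun i => if i ∈ A then x i else 0, ⟨⟨fun j hj i hi => ?_, fun j hj i hi => ?_,
      fun i hi => ?_, ?_⟩, fun i hi => if_neg hi⟩, ?_⟩
    · rw [hon i (Finset.mem_inter.1 hi).1]; exact h1 j hj i hi
    · rw [hon i (Finset.mem_inter.1 hi).1]; exact h2 j hj i hi
    · rw [hon i hi]; exact h3 i hi
    · rw [Finset.sum_congr rfl hon, h4]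
    · exact Finset.sum_congr rfl fun i hi => by rw [hon i hi]
  have hclosed : IsClosed C := by
    have hrepr : C = ((⋂ (j : Fin m) (_ : (j : ℕ) < k) (i) (_ : i ∈ A ∩ S j),
          {x : Fin n → ℝ | x i ≤ p (S j) i}) ∩
        ((⋂ (j : Fin m) (_ : k ≤ (j : ℕ)) (i) (_ : i ∈ A ∩ S j), {x | p (S j) i ≤ x i}) ∩
        ((⋂ (i) (_ : i ∈ A), {x | 0 ≤ x i}) ∩ {x | ∑ i ∈ A, x i = 1}))) ∩
        ⋂ (i) (_ : i ∉ A), {x | x i = 0} := by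
      ext x
      simp only [hC, sandwichRegion, simplexOn, Set.mem_inter_iff, Set.mem_ofPred_eq,
        Set.mem_iInter]
    rw [hrepr]
    refine ((isClosed_iInter fun j => isClosed_iInter fun _ => isClosed_iInter fun i =>
      isClosed_iInter fun _ => isClosed_le (by fun_prop) (by fun_prop)).inter
      ((isClosed_iInter fun j => isClosed_iInter fun _ => isClosed_iInter fun i =>
      isClosed_iInter fun _ => isClosed_le (by fun_prop) (by fun_prop)).inter
      ((isClosed_iInter fun i => isClosed_iInter fun _ => isClosed_le (by fun_prop)
      (by fun_prop)).inter (isClosed_eq (by fun_prop) (by fun_prop))))).inter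
      (isClosed_iInter fun i => isClosed_iInter fun _ => isClosed_eq (by fun_prop) (by fun_prop))
  have hcompact : IsCompact C := by
    refine (isCompact_Icc (a := (0 : Fin n → ℝ)) (b := 1)).of_isClosed_subset hclosed ?_
    rintro x ⟨⟨-, -, hx⟩, h0⟩
    refine ⟨fun i => ?_, fun i => ?_⟩ <;> by_cases hi : i ∈ A
    · exact hx.1 i hi
    · exact (h0 i hi).ge
    · exact le_one_of_mem_simplexOn hx hi
    · exact (h0 i hi).trans_le zero_le_one
  have hCne : C.Nonempty := by
    obtain ⟨x, hx⟩ := hne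
    obtain ⟨y, hy, -⟩ := htrunc x hx
    exact ⟨y, hy⟩
  obtain ⟨y, hy, hmin⟩ := hcompact.exists_isMinOn hCne (f := revenue r A)
    (by unfold revenue; fun_prop)
  refine ⟨y, hy.1, le_antisymm (iInf₂_le y hy.1) (le_iInf₂ fun x hx => ?_)⟩
  obtain ⟨z, hz, he⟩ := htrunc x hx
  rw [← he]
  exact EReal.coe_le_coe_iff.2 (hmin hz)

/-- Any model that produces the data also produces choice probabilities for `A`. -/
theorem consistentSet_nonempty {n : ℕ} {𝒮 : Finset (Finset (Fin n))}
    {p : Finset (Fin n) → Fin n → ℝ} (hp : p ∈ mdmProbabilities 𝒮) {A : Finset (Fin n)}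
    (hA : A.Nonempty) (hA𝒮 : A ∉ 𝒮) : (consistentSet 𝒮 p A).Nonempty := by
  obtain ⟨hs, M, hM⟩ := mem_mdmProbabilities_iff.1 hp
  obtain ⟨l, hl⟩ := M.exists_sum_exceedProb_eq_one hA
  exact ⟨fun i => M.exceedProb i l, (mem_consistentSet_iff hA𝒮).2
    ⟨⟨⟨fun i _ => M.exceedProb_nonneg i l, hl⟩, hs⟩, M, ⟨l, fun _ _ => rfl⟩, hM⟩⟩

theorem proposition3 {n m : ℕ} (𝒮 : Finset (Finset (Fin n))) (S : Fin m → Finset (Fin n))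
    (hS : IsNestedEnumeration 𝒮 S)
    (p : Finset (Fin n) → Fin n → ℝ) (hp : p ∈ mdmProbabilities 𝒮)
    (r : Fin n → ℝ) (hr : ∀ i, 0 < r i)
    (A : Finset (Fin n)) (hA : A.Nonempty) (hA𝒮 : A ∉ 𝒮) :
    IsLeast (Set.range (nestedValue 𝒮 S p r A)) (worstCaseRevenue 𝒮 p r A) ∧
    (∀ k : Fin (m + 1), (nestedFeasible 𝒮 S p A k).Nonempty →
      ∃ x ∈ nestedFeasible 𝒮 S p A k, nestedValue 𝒮 S p r A k = ((revenue r A x : ℝ) : EReal)) ∧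
    ∃ k : Fin (m + 1), (nestedFeasible 𝒮 S p A k).Nonempty := by
  have hlower : worstCaseRevenue 𝒮 p r A ∈ lowerBounds (Set.range (nestedValue 𝒮 S p r A)) := by
    rintro _ ⟨k, rfl⟩
    refine le_iInf₂ fun x hx => infRevenue_le_of_near r fun δ hδ => ?_
    rw [nestedFeasible_eq_sandwichRegion hS hp] at hx
    exact exists_mem_consistentSet_near hS hp hA𝒮 hx hδ
  refine ⟨⟨?_, hlower⟩, fun k hk => ?_, ?_⟩
  -- Take `k` with the smallest program value. Each consistent vector is feasible for some `q`, so
  -- its revenue is at least the value for `q`, hence at least that for `k`.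
  · obtain ⟨k, hk⟩ := exists_eq_ciInf_of_finite (f := nestedValue 𝒮 S p r A)
    refine ⟨k, le_antisymm (le_iInf₂ fun x hx => ?_) (hlower ⟨k, rfl⟩)⟩
    obtain ⟨q, hq⟩ := exists_mem_sandwichRegion hS hp hA𝒮 hx
    rw [← nestedFeasible_eq_sandwichRegion hS hp] at hq
    rw [hk]
    exact (iInf_le _ q).trans (iInf₂_le x hq)
  · rw [nestedValue]
    rw [nestedFeasible_eq_sandwichRegion hS hp] at hk ⊢
    exact exists_revenue_eq_infRevenue S p r A k hk
  · obtain ⟨x, hx⟩ := consistentSet_nonempty hp hA hA𝒮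
    obtain ⟨k, hk⟩ := exists_mem_sandwichRegion hS hp hA𝒮 hx
    exact ⟨k, x, by rwa [nestedFeasible_eq_sandwichRegion hS hp]⟩
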